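/- **Setting.** Let $(\Omega,\mathcal A,\mathbb P)$ be a probability space, $\mathcal X$ a locally compact Polish space, $\mathcal G$ a separable real Hilbert space and $\mathcal Y\subseteq\mathcal G$ a complete subset, all topological spaces being equipped with their Borel $\sigma$-algebras. Let $\mathcal P(S)$ denote the set of Borel probability measures on $S$ with the topology of weak convergence. *RKHS.* Let $\mathcal H$ be a separable $\mathcal G$-valued reproducing kernel Hilbert space on $\mathcal X$, that is, a separable real Hilbert space of functions $f:\mathcal X\to\mathcal G$ for which every evaluation map $S_x:\mathcal H\to\mathcal G$, $f\mapsto f(x)$, is continuous. Put $K(\cdot,x)=S_x^*\in\mathcal L(\mathcal G;\mathcal H)$ and $K(x,x')=S_xS_{x'}^*\in\mathcal L(\mathcal G)$. Assume that all $f\in\mathcal H$ are continuous, that $\sup_{x}\sqrt{\|K(x,x)\|}<\infty$, that the feature map $x\mapsto K(\cdot,x)\in\mathcal L(\mathcal G;\mathcal H)$ is continuous for the operator norm, and that the space $C_b(\mathcal X\times\mathcal Y;\mathcal H)$ of bounded continuous functions is separable for the supremum norm. *Loss.* Let $L:\mathcal X\times\mathcal Y\times\mathcal G\to[0,\infty)$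 be measurable and such that - (convex) $L(x,y,\cdot)$ is convex for all $x,y$; - (continuously differentiable) $L(x,y,\cdot)$ is Fréchet differentiable for all $x,y$, and $(x,y,t)\mapsto\nabla_tL(x,y,t)$ is continuous on $\mathcal X\times\mathcal Y\times\mathcal G$; - (locally Lipschitz) for every $a>0$ there is a constant $M$ with $|L(x,y,t)-L(x,y,t')|\le M\|t-t'\|$ for all $x,y$ and all $t,t'$ with $\|t\|,\|t'\|\le a$; - (locally bounded) $L$ is bounded on $\mathcal X\times\mathcal Y\times A$ for every bounded $A\subseteq\mathcal G$. *Risks.* For $J\in\mathcal P(\mathcal X\times\mathcal Y)$ and measurable $f:\mathcal X\to\mathcal G$ let $\mathcal R_{L,J}(f)=\int L(x,y,f(x))\,dJ(x,y)\in[0,\infty]$, and let $\mathcal R^\star_{L,J}$ be the infimum of $\mathcal R_{L,J}(f)$ over all measurable $f:\mathcal X\to\mathcal G$. The space $\mathcal H$ is called $(L,J)$-rich if $\inf_{f\in\mathcal H}\mathcal R_{L,J}(f)=\mathcal R^\star_{L,J}$. *Process.* Let $Z=(Z_n)_{n\ge1}$ be an $\mathcal X\times\mathcal Y$-valued process, $\eta_n^Z=\frac1n\sum_{i=1}^n\delta_{Z_i}$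 its empirical measures, and $J:\Omega\to\mathcal P(\mathcal X\times\mathcal Y)$ a random measure. $Z$ is *empirically weakly converging (EWC) in probability* with limit measure $J$ if $d(\eta^Z_n,J)\to0$ in probability, where $d$ is a metric that metrizes the weak convergence of probability measures, and *EWC almost surely* with limit measure $J$ if almost surely $\eta_n^Z$ converges weakly to $J$. Assume that $\mathcal H$ is $(L,J)$-rich almost surely. **Theorem.** For every $n\ge1$, every training set $z=((x_i,y_i))_{i=1}^n\in(\mathcal X\times\mathcal Y)^n$ and every $\lambda>0$, the functional $$f\in\mathcal H\;\mapsto\;\frac1n\sum_{i=1}^nL(x_i,y_i,f(x_i))+\lambda\|f\|_{\mathcal H}^2$$ has a unique minimizer $f_{z,\lambda}\in\mathcal H$. Moreover: 1. If $Z$ is EWC in probability with limit measure $J$, then there is a sequence of strictly positive real numbers $(\lambda_n)_{n\ge1}$ with $\lambda_n\to0$ such that the $(\lambda_n)$-SVM is $L$-consistent for $Z$, that is, $\mathcal R_{L,J}(f_{Z_{1:n},\lambda_n})\to\mathcal R^\star_{L,J}$ in probability, where $Z_{1:n}=(Z_1,\dots,Z_n)$. 2. If $Z$ is EWC almost surely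 with limit measure $J$, then there is a sequence of strictly positive real numbers $(\lambda_n)_{n\ge1}$ with $\lambda_n\to0$ such that the $(\lambda_n)$-SVM is strongly $L$-consistent for $Z$, that is, $\mathcal R_{L,J}(f_{Z_{1:n},\lambda_n})\to\mathcal R^\star_{L,J}$ almost surely. -/

import Mathlib

open MeasureTheory Filter Topology
open scoped ENNReal BoundedContinuousFunction

noncomputable section

namespace EWCConsistency

/-! ### Loss functions -/

section Loss

variable {X Y G : Type*}

/-- `L : X × Y × G → [0, ∞)` is a loss function: it is nonnegative and (jointly) measurable. -/
structure IsLoss [MeasurableSpace X] [MeasurableSpace Y] [MeasurableSpace G]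
    (L : X → Y → G → ℝ) : Prop where
  nonneg : ∀ x y t, 0 ≤ L x y t
  measurable : Measurable fun p : X × Y × G => L p.1 p.2.1 p.2.2

/-- The loss is convex in its last argument. -/
def IsConvexLoss [NormedAddCommGroup G] [InnerProductSpace ℝ G] (L : X → Y → G → ℝ) : Prop :=
  ∀ x y, ConvexOn ℝ Set.univ (L x y)

/-- The loss is bounded on `X × Y × A` for every bounded `A ⊆ G`. -/
def IsLocallyBoundedLoss [NormedAddCommGroup G] (L : X → Y → G → ℝ) : Prop :=
  ∀ A : Set G, Bornology.IsBounded A → ∃ M : ℝ, ∀ x y, ∀ t ∈ A, |L x y t| ≤ M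

/-- For every radius `a > 0`, the functions `L x y` are Lipschitz continuous on the ball
`{‖t‖ ≤ a}`, with a constant that does not depend on `x` and `y`. -/
def IsLocallyLipschitzLoss [NormedAddCommGroup G] (L : X → Y → G → ℝ) : Prop :=
  ∀ a : ℝ, 0 < a → ∃ M : ℝ, ∀ x y t t', ‖t‖ ≤ a → ‖t'‖ ≤ a →
    |L x y t - L x y t'| ≤ M * ‖t - t'‖

/-- The loss is Fréchet differentiable in its last argument, and its gradient in this argument
is jointly continuous on `X × Y × G`. -/
structure IsContDiffLoss [TopologicalSpace X] [TopologicalSpace Y] [NormedAddCommGroup G]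
    [InnerProductSpace ℝ G] [CompleteSpace G] (L : X → Y → G → ℝ) : Prop where
  differentiable : ∀ x y, Differentiable ℝ (L x y)
  continuous_gradient :
    Continuous fun p : X × Y × G => gradient (L p.1 p.2.1) p.2.2

end Loss

/-! ### Risks -/

section Risk

variable {X Y G : Type*} [MeasurableSpace X] [MeasurableSpace Y]

/-- The `L`-risk `∫ L(x, y, f(x)) dJ(x, y)`, with values in `[0, ∞]`. -/
def risk (L : X → Y → G → ℝ) (J : ProbabilityMeasure (X × Y)) (f : X → G) : ℝ≥0∞ :=
  ∫⁻ p, ENNReal.ofReal (L p.1 p.2 (f p.1)) ∂(J : Measure (X × Y))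

/-- The Bayes `L`-risk: the infimum of the risk over all measurable functions. -/
def bayesRisk [MeasurableSpace G] (L : X → Y → G → ℝ) (J : ProbabilityMeasure (X × Y)) : ℝ≥0∞ :=
  ⨅ (f : X → G) (_ : Measurable f), risk L J f

/-- The set of functions `F` is `(L, J)`-rich. -/
def IsRich [MeasurableSpace G] (F : Set (X → G)) (L : X → Y → G → ℝ)
    (J : ProbabilityMeasure (X × Y)) : Prop :=
  (⨅ f ∈ F, risk L J f) = bayesRisk L J

end Risk

/-! ### Empirical measures and empirical weak convergence

Processes are indexed by `ℕ`: `Z 0, Z 1, …` stand for the first, second, … observation. The sample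
of size `n + 1` is `(Z 0, …, Z n)`, so that the index `n` in the sequences below always belongs to
samples of size `n + 1`. -/

section Empirical

variable {S : Type*} [MeasurableSpace S]

/-- The empirical measure `(n + 1)⁻¹ ∑ δ_{z i}` of a sample of size `n + 1`. -/
def empiricalMeasure {n : ℕ} (z : Fin (n + 1) → S) : ProbabilityMeasure S :=
  ⟨((n + 1 : ℕ) : ℝ≥0∞)⁻¹ • ∑ i, Measure.dirac (z i), by
    constructor
    simp only [Measure.smul_apply, Measure.coe_finsetSum, Finset.sum_apply, measure_univ,
      Finset.sum_const, Finset.card_univ, Fintype.card_fin, nsmul_eq_mul, mul_one, smul_eq_mul]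
    exact ENNReal.inv_mul_cancel (by simp) (ENNReal.natCast_ne_top _)⟩

/-- The first `n + 1` observations of the process `Z` at the outcome `ω`. -/
def sample {Ω : Type*} (Z : ℕ → Ω → S) (n : ℕ) (ω : Ω) : Fin (n + 1) → S :=
  fun i => Z i ω

variable [TopologicalSpace S] [OpensMeasurableSpace S]

/-- The process `Z` is empirically weakly converging in probability with (random) limit measure
`J`: for a metric `d` that metrizes weak convergence of probability measures, the distance of the
empirical measure of the first `n + 1` observations to `J` tends to zero in probability. -/
structure IsEWCInProb {Ω : Type*} [MeasurableSpace Ω] (P : Measure Ω) (Z : ℕ → Ω → S)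
    (J : Ω → ProbabilityMeasure S) : Prop where
  measurable_process : ∀ n, Measurable (Z n)
  measurable_limit : Measurable J
  tendsto : ∃ d : MetricSpace (ProbabilityMeasure S),
    d.toPseudoMetricSpace.toUniformSpace.toTopologicalSpace =
      (inferInstance : TopologicalSpace (ProbabilityMeasure S)) ∧
    ∀ ε : ℝ, 0 < ε →
      Tendsto (fun n => P {ω | ε ≤ d.dist (empiricalMeasure (sample Z n ω)) (J ω)}) atTop (𝓝 0)

/-- The process `Z` is empirically weakly converging almost surely with (random) limit measure
`J`: almost surely, the empirical measures converge weakly to `J`. -/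
structure IsEWCAlmostSurely {Ω : Type*} [MeasurableSpace Ω] (P : Measure Ω) (Z : ℕ → Ω → S)
    (J : Ω → ProbabilityMeasure S) : Prop where
  measurable_process : ∀ n, Measurable (Z n)
  measurable_limit : Measurable J
  tendsto : ∀ᵐ ω ∂P, Tendsto (fun n => empiricalMeasure (sample Z n ω)) atTop (𝓝 (J ω))

end Empirical

/-! ### Learning methods and consistency -/

section Learning

variable {X Y G : Type*} [MeasurableSpace X] [MeasurableSpace Y] [MeasurableSpace G]

/-- A learning method maps every training set of size `n + 1` to a measurable function. -/
abbrev LearningMethod (X Y G : Type*) [MeasurableSpace X] [MeasurableSpace G] : Type _ :=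
  (n : ℕ) → (Fin (n + 1) → X × Y) → {f : X → G // Measurable f}

/-- `L`-consistency for the process `Z` with random limit measure `J`: the risks (with respect to
`J`) of the learned functions converge in probability to the Bayes risk. -/
def IsConsistent {Ω : Type*} [MeasurableSpace Ω] (P : Measure Ω) (L : X → Y → G → ℝ)
    (𝔏 : LearningMethod X Y G) (Z : ℕ → Ω → X × Y) (J : Ω → ProbabilityMeasure (X × Y)) : Prop :=
  TendstoInMeasure P (fun n ω => risk L (J ω) (𝔏 n (sample Z n ω)).1) atTop
    (fun ω => bayesRisk L (J ω))

/-- Strong `L`-consistency: the same convergence, almost surely. -/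
def IsStronglyConsistent {Ω : Type*} [MeasurableSpace Ω] (P : Measure Ω) (L : X → Y → G → ℝ)
    (𝔏 : LearningMethod X Y G) (Z : ℕ → Ω → X × Y) (J : Ω → ProbabilityMeasure (X × Y)) : Prop :=
  ∀ᵐ ω ∂P, Tendsto (fun n => risk L (J ω) (𝔏 n (sample Z n ω)).1) atTop (𝓝 (bayesRisk L (J ω)))

end Learning

/-! ### Support vector machines -/

section SVM

variable {X Y G : Type*} [MeasurableSpace X] [MeasurableSpace Y]
  [NormedAddCommGroup G] [InnerProductSpace ℝ G]
  {H : Type*} [NormedAddCommGroup H] [InnerProductSpace ℝ H] [RKHS ℝ H X G]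

/-- The regularized empirical risk `R_{L, η_z}(f) + lam ‖f‖²` of `f ∈ H` on the training set `z`. -/
def regularizedRisk (L : X → Y → G → ℝ) (lam : ℝ) {n : ℕ} (z : Fin (n + 1) → X × Y)
    (f : H) : ℝ≥0∞ :=
  risk L (empiricalMeasure z) (f : X → G) + ENNReal.ofReal (lam * ‖f‖ ^ 2)

/-- `f` minimizes the regularized empirical risk over `H`. -/
def IsSVMSolution (L : X → Y → G → ℝ) (lam : ℝ) {n : ℕ} (z : Fin (n + 1) → X × Y)
    (f : H) : Prop :=
  ∀ g : H, regularizedRisk L lam z f ≤ regularizedRisk L lam z g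

variable (H) in
/-- The minimizer of the regularized empirical risk over `H` (an arbitrary element of `H` if there
is none). -/
def svmSolution (L : X → Y → G → ℝ) (lam : ℝ) {n : ℕ} (z : Fin (n + 1) → X × Y) : H :=
  Classical.epsilon fun f : H => IsSVMSolution L lam z f

variable (H) in
/-- The `(lam n)`-SVM: the learning method that maps a training set of size `n + 1` to the minimizer
of the regularized empirical risk with regularization parameter `lam n`. -/
def svm [MeasurableSpace G] (hH : ∀ f : H, Measurable (f : X → G)) (L : X → Y → G → ℝ)
    (lam : ℕ → ℝ) : LearningMethod X Y G :=
  fun n z => ⟨svmSolution H L (lam n) z, hH _⟩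

end SVM

end EWCConsistency

end

noncomputable section

namespace EWCConsistency

/-! For fixed λ > 0 the regularized risk has a unique minimizer f_{J,λ} for every probability
measure J, not only for empirical ones, and the whole theorem rests on its continuous dependence on
J in the weak topology (`continuous_regMinimizer`). Let Φ be the H-valued gradient of the loss along
f_{J,λ}. Convexity and the first order condition at f_{J,λ} give the stability bound λ‖f_{J',λ} -
f_{J,λ}‖ ≤ ‖∫Φ dJ' - ∫Φ dJ‖ (`norm_regMinimizer_sub_le`). Since Φ is bounded and continuous, weak
convergence makes the right side small (`tendsto_integral_hilbert`).

For fixed λ, empirical weak convergence thus forces f_{η_n,λ} → f_{J,λ} in H, and the risk is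
Lipschitz on bounded sets of H, uniformly in J (`exists_excess_le`). Richness gives R_J(f_{J,λ}) →
R*_J as λ → 0 (`tendsto_realRisk_regMinimizer`). It remains to let λ_n = 1/(κ(n)+1) decrease so
slowly that the first error still vanishes: this is a diagonal argument, in probability
(`exists_diagonal_tendsto_measure`) or almost surely (`exists_diagonal_tendsto_ae`).

Because J is random, continuity alone does not transfer convergence in probability; J must also be
measurable for the weak Borel σ-algebra. Separability of the bounded continuous functions provides
this (`opensMeasurableSpace_probabilityMeasure`), except when H is trivial, where every learned
function already has the Bayes risk. -/

/-! ### Minimization under strong midpoint convexity -/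

/-- A nonnegative continuous function on a Banach space that is strongly midpoint convex has a
unique minimizer. -/
theorem existsUnique_forall_le_of_midpoint {E : Type*} [NormedAddCommGroup E] [NormedSpace ℝ E]
    [CompleteSpace E] {T : E → ℝ} (hT : Continuous T) (h0 : ∀ x, 0 ≤ T x) {c : ℝ} (hc : 0 < c)
    (hmid : ∀ x y, T ((1 / 2 : ℝ) • (x + y)) ≤ (T x + T y) / 2 - c * ‖x - y‖ ^ 2) :
    ∃! x, ∀ y, T x ≤ T y := by
  have hbdd : BddBelow (Set.range T) := ⟨0, by rintro _ ⟨x, rfl⟩; exact h0 x⟩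
  set m := ⨅ x, T x with hm
  have hle : ∀ x, m ≤ T x := fun x => ciInf_le hbdd x
  have hex : ∀ n : ℕ, ∃ x, T x < m + 1 / ((n : ℝ) + 1) := fun n =>
    exists_lt_of_ciInf_lt (by rw [← hm]; linarith [Nat.one_div_pos_of_nat (α := ℝ) (n := n)])
  choose u hu using hex
  have hlim : Tendsto (fun n : ℕ => 1 / ((n : ℝ) + 1)) atTop (𝓝 0) :=
    tendsto_one_div_add_atTop_nhds_zero_nat
  -- The midpoint of two near-minimizers cannot fall below the infimum, so c‖u n - u k‖² is at most
  -- the larger of their two gaps.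
  have hcauchy : CauchySeq u := by
    refine cauchySeq_of_le_tendsto_0 (fun N : ℕ => Real.sqrt ((1 / ((N : ℝ) + 1)) / c)) ?_ ?_
    · intro n k N hn hk
      rw [dist_eq_norm]
      apply Real.le_sqrt_of_sq_le
      rw [le_div_iff₀ hc]
      have h1 := hmid (u n) (u k)
      have h2 := hle ((1 / 2 : ℝ) • (u n + u k))
      have h3 := hu n
      have h4 := hu k
      have h5 := Nat.one_div_le_one_div (α := ℝ) hn
      have h6 := Nat.one_div_le_one_div (α := ℝ) hk
      linarith
    · have := (hlim.div_const c).sqrt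
      simpa using this
  obtain ⟨x, hx⟩ := cauchySeq_tendsto_of_complete hcauchy
  have hxm : T x ≤ m := by
    refine le_of_tendsto_of_tendsto' ((hT.tendsto x).comp hx) (?_ : Tendsto
      (fun n : ℕ => m + 1 / ((n : ℝ) + 1)) atTop (𝓝 m)) (fun n => (hu n).le)
    simpa using hlim.const_add m
  refine ⟨x, fun y => hxm.trans (hle y), fun y hy => ?_⟩
  have h1 := hmid y x
  have h2 := hle ((1 / 2 : ℝ) • (y + x))
  have h3 := hy x
  have h4 : ‖y - x‖ ^ 2 ≤ 0 := by
    by_contra! h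
    have := mul_pos hc h
    linarith
  have h5 : ‖y - x‖ = 0 := by nlinarith [norm_nonneg (y - x)]
  exact sub_eq_zero.mp (norm_eq_zero.mp h5)

/-! ### Weak convergence and Hilbert-valued integrals -/

theorem integrable_of_continuous_of_norm_le {S E : Type*} [TopologicalSpace S] [MeasurableSpace S]
    [OpensMeasurableSpace S] [NormedAddCommGroup E] [SecondCountableTopology E]
    (μ : Measure S) [IsFiniteMeasure μ] {f : S → E} (hf : Continuous f) {C : ℝ}
    (hC : ∀ s, ‖f s‖ ≤ C) : Integrable f μ := by
  borelize E
  exact Integrable.of_bound hf.measurable.aestronglyMeasurable C (ae_of_all _ hC)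

theorem tendsto_integral_of_continuous_of_norm_le {S : Type*} [TopologicalSpace S]
    [MeasurableSpace S] [OpensMeasurableSpace S] {ι : Type*} {l : Filter ι}
    {μs : ι → ProbabilityMeasure S} {μ : ProbabilityMeasure S} (h : Tendsto μs l (𝓝 μ))
    {f : S → ℝ} (hf : Continuous f) {C : ℝ} (hC : ∀ s, |f s| ≤ C) :
    Tendsto (fun i => ∫ s, f s ∂(μs i : Measure S)) l (𝓝 (∫ s, f s ∂(μ : Measure S))) :=
  ProbabilityMeasure.tendsto_iff_forall_integral_tendsto.mp h
    (BoundedContinuousFunction.ofNormedAddCommGroup f hf C hC)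

theorem norm_sub_starProjection_le {E : Type*} [NormedAddCommGroup E] [InnerProductSpace ℝ E]
    (U : Submodule ℝ E) [U.HasOrthogonalProjection] (x : E) :
    ‖x - U.starProjection x‖ ≤ ‖x‖ := by
  rw [← Submodule.starProjection_orthogonal_val]
  exact Submodule.norm_starProjection_apply_le _ x

/-- If `⟪v, y i⟫` converges to `⟪v, y₀⟫` for every `v`, then so do the projections onto a
finite-dimensional subspace. -/
theorem tendsto_starProjection_of_tendsto_inner {E : Type*} [NormedAddCommGroup E]
    [InnerProductSpace ℝ E] (U : Submodule ℝ E) [FiniteDimensional ℝ U] {ι : Type*} {l : Filter ι}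
    {y : ι → E} {y₀ : E} (h : ∀ v : E, Tendsto (fun i => inner ℝ v (y i)) l (𝓝 (inner ℝ v y₀))) :
    Tendsto (fun i => U.starProjection (y i)) l (𝓝 (U.starProjection y₀)) := by
  have hsum : ∀ x : E, U.starProjection x =
      ∑ j, (inner ℝ ((stdOrthonormalBasis ℝ U j : U) : E) x) •
        ((stdOrthonormalBasis ℝ U j : U) : E) := by
    intro x
    rw [Submodule.starProjection_apply,
      (stdOrthonormalBasis ℝ U).orthogonalProjectionOnto_apply_eq_sum x]
    simp
  simp_rw [hsum]
  exact tendsto_finsetSum _ fun j _ => (h _).smul_const _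

/-- Weak convergence of probability measures implies convergence of the integrals of bounded
continuous functions with values in a separable Hilbert space. -/
theorem tendsto_integral_hilbert {S E : Type*} [TopologicalSpace S] [MeasurableSpace S]
    [OpensMeasurableSpace S] [NormedAddCommGroup E] [InnerProductSpace ℝ E] [CompleteSpace E]
    [TopologicalSpace.SeparableSpace E] {ι : Type*} {l : Filter ι}
    {μs : ι → ProbabilityMeasure S} {μ : ProbabilityMeasure S} (h : Tendsto μs l (𝓝 μ))
    {Φ : S → E} (hΦ : Continuous Φ) {C : ℝ} (hC : ∀ s, ‖Φ s‖ ≤ C) :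
    Tendsto (fun i => ∫ s, Φ s ∂(μs i : Measure S)) l (𝓝 (∫ s, Φ s ∂(μ : Measure S))) := by
  have : SecondCountableTopology E := UniformSpace.secondCountable_of_separable E
  -- An increasing sequence of finite-dimensional subspaces with dense union: convergence is scalar
  -- inside each `U n`, and the component outside is controlled in mean.
  let U : ℕ → Submodule ℝ E := fun n =>
    Submodule.span ℝ (TopologicalSpace.denseSeq E '' Set.Iic n)
  have hU : Monotone U := fun m n hmn =>
    Submodule.span_mono (Set.image_mono (Set.Iic_subset_Iic.mpr hmn))
  have hfin : ∀ n, FiniteDimensional ℝ (U n) := fun n =>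
    FiniteDimensional.span_of_finite ℝ ((Set.finite_Iic n).image _)
  have htop : ⊤ ≤ (⨆ n, U n).topologicalClosure := by
    rw [← SetLike.coe_subset_coe, Submodule.topologicalClosure_coe, Submodule.top_coe,
      ← (TopologicalSpace.denseRange_denseSeq E).closure_range]
    refine closure_mono ?_
    rintro _ ⟨n, rfl⟩
    exact (le_iSup U n) (Submodule.subset_span ⟨n, Set.mem_Iic.mpr le_rfl, rfl⟩)
  have hΦi : ∀ ν : ProbabilityMeasure S, Integrable Φ (ν : Measure S) := fun ν =>
    integrable_of_continuous_of_norm_le _ hΦ hC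
  have hrc : ∀ n, Continuous fun s => ‖Φ s - (U n).starProjection (Φ s)‖ := fun n => by fun_prop
  have hrC : ∀ n s, ‖Φ s - (U n).starProjection (Φ s)‖ ≤ C := fun n s =>
    (norm_sub_starProjection_le _ _).trans (hC s)
  have hrest : ∀ n (ν : ProbabilityMeasure S),
      ‖∫ s, Φ s ∂(ν : Measure S) - (U n).starProjection (∫ s, Φ s ∂(ν : Measure S))‖ ≤
        ∫ s, ‖Φ s - (U n).starProjection (Φ s)‖ ∂(ν : Measure S) := by
    intro n ν
    rw [← ContinuousLinearMap.integral_comp_comm _ (hΦi ν),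
      ← integral_sub (hΦi ν) ((U n).starProjection.integrable_comp (hΦi ν))]
    exact norm_integral_le_integral_norm _
  have hdct : Tendsto (fun n => ∫ s, ‖Φ s - (U n).starProjection (Φ s)‖ ∂(μ : Measure S)) atTop
      (𝓝 0) := by
    have := tendsto_integral_of_dominated_convergence (μ := (μ : Measure S))
      (F := fun n s => ‖Φ s - (U n).starProjection (Φ s)‖) (f := fun _ => (0 : ℝ)) (fun _ => C)
      (fun n => (hrc n).measurable.aestronglyMeasurable) (integrable_const C)
      (fun n => ae_of_all _ fun s => by simpa using hrC n s)
      (ae_of_all _ fun s => by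
        have := (Submodule.starProjection_tendsto_self U hU (Φ s) htop).const_sub (Φ s)
        simpa using this.norm)
    simpa using this
  rw [Metric.tendsto_nhds]
  intro ε hε
  obtain ⟨n, hn⟩ := (hdct.eventually (gt_mem_nhds (show (0 : ℝ) < ε / 3 by positivity))).exists
  -- The norm of the tail is itself a bounded continuous real function, so its small mean under `μ`
  -- passes to `μs i` eventually; no tightness is needed.
  have h1 := (tendsto_integral_of_continuous_of_norm_le h (hrc n) (C := C)
    (fun s => by simpa using hrC n s)).eventually (gt_mem_nhds hn)
  have h2 := tendsto_starProjection_of_tendsto_inner (U n) (l := l)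
    (y := fun i => ∫ s, Φ s ∂(μs i : Measure S)) (y₀ := ∫ s, Φ s ∂(μ : Measure S)) (fun v => by
      have hv : ∀ ν : ProbabilityMeasure S, inner ℝ v (∫ s, Φ s ∂(ν : Measure S)) =
          ∫ s, inner ℝ v (Φ s) ∂(ν : Measure S) := fun ν =>
        (integral_inner (hΦi ν) v).symm
      simp_rw [hv]
      refine tendsto_integral_of_continuous_of_norm_le h (C := ‖v‖ * C) (by fun_prop) fun s => ?_
      exact (abs_real_inner_le_norm _ _).trans
        (mul_le_mul_of_nonneg_left (hC s) (norm_nonneg v)))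
  have h3 := (Metric.tendsto_nhds.mp h2) (ε / 3) (by positivity)
  filter_upwards [h1, h3] with i hi1 hi3
  have e1 := hrest n (μs i)
  have e2 := hrest n μ
  rw [dist_eq_norm] at hi3 ⊢
  rw [norm_sub_rev] at e2
  calc ‖∫ s, Φ s ∂(μs i : Measure S) - ∫ s, Φ s ∂(μ : Measure S)‖
      = ‖(∫ s, Φ s ∂(μs i : Measure S) - (U n).starProjection (∫ s, Φ s ∂(μs i : Measure S)))
        + ((U n).starProjection (∫ s, Φ s ∂(μs i : Measure S))
          - (U n).starProjection (∫ s, Φ s ∂(μ : Measure S)))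
        + ((U n).starProjection (∫ s, Φ s ∂(μ : Measure S)) - ∫ s, Φ s ∂(μ : Measure S))‖ := by
        congr 1; abel
    _ ≤ _ := norm_add₃_le
    _ < ε := by linarith

/-- If the space of bounded continuous real functions is separable, then the evaluation
`σ`-algebra on probability measures contains the weakly open sets. -/
theorem opensMeasurableSpace_probabilityMeasure {S : Type*} [TopologicalSpace S]
    [MeasurableSpace S] [OpensMeasurableSpace S] [TopologicalSpace.SeparableSpace (S →ᵇ ℝ)] :
    OpensMeasurableSpace (ProbabilityMeasure S) := by
  let φ : ℕ → (S →ᵇ ℝ) := TopologicalSpace.denseSeq (S →ᵇ ℝ)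
  -- Integrals against a countable dense family of test functions are measurable coordinates. They
  -- induce the weak topology, because uniform approximation of a test function changes all
  -- integrals uniformly in the measure.
  let e : ProbabilityMeasure S → ℕ → ℝ := fun μ k => ∫ s, φ k s ∂(μ : Measure S)
  have hem : Measurable e := by
    refine measurable_pi_lambda _ fun k => ?_
    let κ : ProbabilityTheory.Kernel (ProbabilityMeasure S) S :=
      ⟨fun μ => (μ : Measure S), measurable_subtype_coe⟩
    exact ((φ k).continuous.measurable.stronglyMeasurable.integral_kernel (κ := κ)).measurable
  have hei : IsInducing e := by
    refine isInducing_iff_nhds.mpr fun μ => le_antisymm ?_ ?_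
    · refine map_le_iff_le_comap.mp (tendsto_pi_nhds.mpr fun k => ?_)
      exact ProbabilityMeasure.tendsto_iff_forall_integral_tendsto.mp tendsto_id (φ k)
    · have hcomap : ∀ k, Tendsto (fun ν : ProbabilityMeasure S => ∫ s, φ k s ∂(ν : Measure S))
          (comap e (𝓝 (e μ))) (𝓝 (∫ s, φ k s ∂(μ : Measure S))) := fun k =>
        tendsto_pi_nhds.mp (tendsto_comap (f := e) (x := 𝓝 (e μ))) k
      refine tendsto_id'.mp (ProbabilityMeasure.tendsto_iff_forall_integral_tendsto.mpr
        fun f => ?_)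
      rw [Metric.tendsto_nhds]
      intro ε hε
      obtain ⟨k, hk⟩ := (TopologicalSpace.denseRange_denseSeq (S →ᵇ ℝ)).exists_dist_lt f
        (show 0 < ε / 3 by positivity)
      have hfk : ∀ ν : ProbabilityMeasure S,
          |∫ s, f s ∂(ν : Measure S) - ∫ s, φ k s ∂(ν : Measure S)| ≤ ε / 3 := by
        intro ν
        rw [← integral_sub (f.integrable _) ((φ k).integrable _)]
        have := norm_integral_le_of_norm_le_const (μ := (ν : Measure S))
          (f := fun s => f s - φ k s) (C := ε / 3) (ae_of_all _ fun s => by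
            rw [← dist_eq_norm]; exact (BoundedContinuousFunction.dist_coe_le_dist s).trans hk.le)
        simpa using this
      filter_upwards [Metric.tendsto_nhds.mp (hcomap k) (ε / 3) (by positivity)] with ν hν
      have h1 := abs_le.mp (hfk ν)
      have h2 := abs_le.mp (hfk μ)
      rw [Real.dist_eq] at hν ⊢
      have h3 := abs_lt.mp hν
      simp only [id]
      rw [abs_lt]
      constructor <;> linarith
  refine ⟨MeasurableSpace.generateFrom_le fun s hs => ?_⟩
  obtain ⟨t, ht, rfl⟩ := hei.isOpen_iff.mp hs
  exact hem ht.measurableSet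

/-! ### Convergence in probability and diagonal arguments -/

/-- A diagonal sequence: if every `p k` holds eventually, then `p (κ n) n` holds eventually for
some sequence `κ` that tends to infinity. -/
theorem exists_tendsto_atTop_forall_eventually {p : ℕ → ℕ → Prop}
    (hp : ∀ k, ∀ᶠ n in atTop, p k n) :
    ∃ κ : ℕ → ℕ, Tendsto κ atTop atTop ∧ ∀ᶠ n in atTop, p (κ n) n := by
  classical
  -- The largest k ≤ n for which `p k n` holds. `Nat.findGreatest` returns 0 if there is none, which
  -- is harmless once `p 0 n` holds.
  refine ⟨fun n => Nat.findGreatest (fun k => p k n) n, ?_, ?_⟩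
  · rw [tendsto_atTop]
    intro k
    filter_upwards [hp k, eventually_ge_atTop k] with n hn hkn
    exact Nat.le_findGreatest hkn hn
  · filter_upwards [hp 0] with n hn
    exact Nat.findGreatest_spec (P := fun k => p k n) (Nat.zero_le n) hn

/-- Convergence in probability is preserved by continuous maps, also if the limit is random. -/
theorem tendsto_measure_dist_comp {Ω M E : Type*} [MeasurableSpace Ω] (P : Measure Ω)
    [IsFiniteMeasure P] [t : TopologicalSpace M] [MeasurableSpace M] [OpensMeasurableSpace M]
    [PseudoMetricSpace E] (d : MetricSpace M)
    (hd : d.toPseudoMetricSpace.toUniformSpace.toTopologicalSpace = t) {η : ℕ → Ω → M} {J : Ω → M}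
    (hJ : Measurable J)
    (h : ∀ ε : ℝ, 0 < ε → Tendsto (fun n => P {ω | ε ≤ d.dist (η n ω) (J ω)}) atTop (𝓝 0))
    {F : M → E} (hF : Continuous F) {δ : ℝ} (hδ : 0 < δ) :
    Tendsto (fun n => P {ω | δ ≤ dist (F (η n ω)) (F (J ω))}) atTop (𝓝 0) := by
  subst hd
  -- Points at which radius 1/(m+1) works for `δ`. A single modulus need not serve all values of
  -- `J`, but the sets `U m` increase to the whole space, so one `m` serves outside an event of
  -- small probability. Taking the interior makes `U m` open, so that its preimage under `J` is
  -- measurable.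
  let U : ℕ → Set M := fun m =>
    interior {μ | ∀ ν, dist ν μ < 1 / ((m : ℝ) + 1) → dist (F ν) (F μ) < δ}
  have hmono : Monotone U := fun m n hmn => interior_mono fun μ hμ ν hν =>
    hμ ν (hν.trans_le (Nat.one_div_le_one_div hmn))
  have hcover : ⋂ m, (J ⁻¹' (U m))ᶜ = ∅ := by
    refine Set.eq_empty_of_forall_notMem fun ω hω => ?_
    obtain ⟨r, hr, hrF⟩ := Metric.continuous_iff.mp hF (J ω) (δ / 2) (by positivity)
    obtain ⟨m, hm⟩ := exists_nat_one_div_lt (show 0 < r / 2 by positivity)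
    refine Set.mem_iInter.mp hω m (mem_interior_iff_mem_nhds.mpr ?_)
    filter_upwards [Metric.ball_mem_nhds (J ω) (show 0 < r / 2 by positivity)] with μ hμ ν hν
    rw [Metric.mem_ball] at hμ
    have h1 := hrF μ (by linarith)
    have h2 := hrF ν (by linarith [dist_triangle ν μ (J ω)])
    linarith [dist_triangle_right (F ν) (F μ) (F (J ω))]
  have hlim : Tendsto (fun m => P (J ⁻¹' (U m))ᶜ) atTop (𝓝 0) := by
    have := tendsto_measure_iInter_atTop (μ := P) (s := fun m => (J ⁻¹' (U m))ᶜ)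
      (fun m => (hJ isOpen_interior.measurableSet).compl.nullMeasurableSet)
      (fun m n hmn => Set.compl_subset_compl.mpr (Set.preimage_mono (hmono hmn)))
      ⟨0, measure_ne_top _ _⟩
    rw [hcover, measure_empty] at this
    exact this
  rw [ENNReal.tendsto_nhds_zero] at hlim ⊢
  intro ε hε
  obtain ⟨m, hm⟩ := (hlim (ε / 2) (ENNReal.half_pos hε.ne')).exists
  filter_upwards [(ENNReal.tendsto_nhds_zero.mp (h (1 / ((m : ℝ) + 1)) (by positivity))) (ε / 2)
    (ENNReal.half_pos hε.ne')] with n hn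
  calc P {ω | δ ≤ dist (F (η n ω)) (F (J ω))}
      ≤ P ({ω | 1 / ((m : ℝ) + 1) ≤ dist (η n ω) (J ω)} ∪ (J ⁻¹' (U m))ᶜ) := by
        refine measure_mono fun ω hω => ?_
        by_contra hcon
        simp only [Set.mem_union, Set.mem_ofPred_eq, not_or, not_le, Set.mem_compl_iff,
          not_not] at hcon
        exact absurd (interior_subset hcon.2 _ hcon.1) (not_lt.mpr hω)
    _ ≤ _ := measure_union_le _ _
    _ ≤ ε / 2 + ε / 2 := add_le_add hn hm
    _ = ε := ENNReal.add_halves ε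

/-- Diagonal argument for convergence in probability. -/
theorem exists_diagonal_tendsto_measure {Ω : Type*} [MeasurableSpace Ω] (P : Measure Ω)
    {D : ℕ → ℕ → Ω → ℝ}
    (hD : ∀ k, ∀ δ : ℝ, 0 < δ → Tendsto (fun n => P {ω | δ ≤ D k n ω}) atTop (𝓝 0)) :
    ∃ κ : ℕ → ℕ, Tendsto κ atTop atTop ∧
      ∀ δ : ℝ, 0 < δ → Tendsto (fun n => P {ω | δ ≤ D (κ n) n ω}) atTop (𝓝 0) := by
  -- The threshold and the probability bound both shrink with `k`, so one diagonal sequence handles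
  -- every `δ`.
  obtain ⟨κ, hκ, hp⟩ := exists_tendsto_atTop_forall_eventually
    (p := fun k n => P {ω | 1 / ((k : ℝ) + 1) ≤ D k n ω} ≤ ((k : ℝ≥0∞) + 1)⁻¹) (fun k =>
      ENNReal.tendsto_nhds_zero.mp (hD k _ Nat.one_div_pos_of_nat) _ (by simp))
  refine ⟨κ, hκ, fun δ hδ => ?_⟩
  have h1 : Tendsto (fun n => ((κ n : ℝ≥0∞) + 1)⁻¹) atTop (𝓝 0) := by
    have := ((tendsto_add_atTop_iff_nat 1).mpr ENNReal.tendsto_inv_nat_nhds_zero).comp hκ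
    simpa [Function.comp_def] using this
  refine tendsto_of_tendsto_of_tendsto_of_le_of_le' tendsto_const_nhds h1
    (Eventually.of_forall fun _ => zero_le) ?_
  have h2 := ((tendsto_one_div_add_atTop_nhds_zero_nat (𝕜 := ℝ)).comp hκ).eventually
    (gt_mem_nhds hδ)
  filter_upwards [hp, h2] with n hn hn2
  exact (measure_mono fun ω (hω : δ ≤ _) => hn2.le.trans hω).trans hn

/-- Diagonal argument for almost sure convergence. -/
theorem exists_diagonal_tendsto_ae {Ω : Type*} [MeasurableSpace Ω] (P : Measure Ω)
    [IsFiniteMeasure P] {D : ℕ → ℕ → Ω → ℝ} (hm : ∀ k n, Measurable (D k n))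
    (h0 : ∀ k n ω, 0 ≤ D k n ω) (hD : ∀ k, ∀ᵐ ω ∂P, Tendsto (fun n => D k n ω) atTop (𝓝 0)) :
    ∃ κ : ℕ → ℕ, Tendsto κ atTop atTop ∧
      ∀ᵐ ω ∂P, Tendsto (fun n => D (κ n) n ω) atTop (𝓝 0) := by
  -- Tail events: in `B k n` the threshold 1/(k+1) is reached at some time from `n` on. They
  -- decrease to a null set in `n`.
  let B : ℕ → ℕ → Set Ω := fun k n => ⋃ m ≥ n, {ω | 1 / ((k : ℝ) + 1) ≤ D k m ω}
  have hB : ∀ k, Tendsto (fun n => P (B k n)) atTop (𝓝 0) := by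
    intro k
    have h1 := tendsto_measure_iInter_atTop (μ := P) (s := B k)
      (fun n => (MeasurableSet.iUnion fun m => MeasurableSet.iUnion fun _ =>
        measurableSet_le measurable_const (hm k m)).nullMeasurableSet)
      (fun n n' hn => Set.biUnion_subset_biUnion_left fun m (hm : n' ≤ m) => hn.trans hm)
      ⟨0, measure_ne_top _ _⟩
    have h2 : P (⋂ n, B k n) = 0 := by
      refine measure_mono_null (fun ω hω => ?_) (ae_iff.mp (hD k))
      intro (hlim : Tendsto _ _ _)
      obtain ⟨N, hN⟩ := eventually_atTop.mp
        (hlim.eventually (gt_mem_nhds (Nat.one_div_pos_of_nat (α := ℝ) (n := k))))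
      obtain ⟨m, hmN, hmB⟩ := Set.mem_iUnion₂.mp (Set.mem_iInter.mp hω N)
      exact absurd (hN m hmN) (not_lt.mpr hmB)
    rw [h2] at h1
    exact h1
  -- Geometric bounds are summable over `k`, so by Borel–Cantelli almost every outcome lies in only
  -- finitely many `B k (N k)`. The sequence `κ` below selects index `k` only after time `N k`.
  have hN : ∀ k, ∃ N, P (B k N) ≤ (2 : ℝ≥0∞)⁻¹ ^ k := fun k =>
    (ENNReal.tendsto_nhds_zero.mp (hB k) _ (ENNReal.pow_pos (by simp) k)).exists
  choose N hN using hN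
  obtain ⟨κ, hκ, hp⟩ := exists_tendsto_atTop_forall_eventually
    (p := fun k n => N k ≤ n) (fun k => eventually_ge_atTop (N k))
  refine ⟨κ, hκ, ?_⟩
  have hsum : ∑' k, P (B k (N k)) ≠ ∞ := by
    refine ne_top_of_le_ne_top ?_ (ENNReal.tsum_le_tsum hN)
    rw [ENNReal.tsum_geometric]
    simp
  filter_upwards [ae_eventually_notMem hsum] with ω hω
  have h2 := (tendsto_one_div_add_atTop_nhds_zero_nat (𝕜 := ℝ)).comp hκ
  refine tendsto_of_tendsto_of_tendsto_of_le_of_le' tendsto_const_nhds h2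
    (Eventually.of_forall fun n => h0 _ _ _) ?_
  filter_upwards [hκ.eventually hω, hp] with n hn hpn
  by_contra! hcon
  exact hn (Set.mem_iUnion₂.mpr ⟨n, hpn, hcon.le⟩)

theorem edist_eq_ofReal_abs_toReal_sub {a b : ℝ≥0∞} (ha : a ≠ ∞) (hb : b ≠ ∞) :
    edist a b = ENNReal.ofReal |a.toReal - b.toReal| := by
  lift a to NNReal using ha
  lift b to NNReal using hb
  have h : edist (a : ℝ≥0∞) b = edist a b := rfl
  rw [h, edist_dist, NNReal.dist_eq]
  rfl

/-! ### Regularized risks and their minimizers -/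

section RegularizedRisk

set_option linter.unusedSectionVars false

variable {X Y G H : Type*}
  [TopologicalSpace X] [SecondCountableTopology X] [MeasurableSpace X] [BorelSpace X]
  [TopologicalSpace Y] [SecondCountableTopology Y] [MeasurableSpace Y] [BorelSpace Y]
  [NormedAddCommGroup G] [InnerProductSpace ℝ G] [CompleteSpace G]
  [SecondCountableTopology G] [MeasurableSpace G] [BorelSpace G]
  [NormedAddCommGroup H] [InnerProductSpace ℝ H] [CompleteSpace H]
  [SecondCountableTopology H] [RKHS ℝ H X G]

variable (H) in
/-- The standing assumptions on the hypothesis space, whose feature map is bounded by `κ`, and on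
the loss. -/
structure IsRegularSetting (L : X → Y → G → ℝ) (κ : ℝ) : Prop where
  continuous_coe : ∀ f : H, Continuous (f : X → G)
  nonneg : 0 ≤ κ
  norm_kerFun_le : ∀ x : X, ‖RKHS.kerFun H x‖ ≤ κ
  continuous_kerFun : Continuous fun x : X => RKHS.kerFun H x
  isLoss : IsLoss L
  isConvexLoss : IsConvexLoss L
  isContDiffLoss : IsContDiffLoss L
  isLocallyLipschitzLoss : IsLocallyLipschitzLoss L
  isLocallyBoundedLoss : IsLocallyBoundedLoss L

/-- The risk of `f`, as a real number. -/
def realRisk (L : X → Y → G → ℝ) (J : ProbabilityMeasure (X × Y)) (f : X → G) : ℝ :=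
  ∫ p, L p.1 p.2 (f p.1) ∂(J : Measure (X × Y))

/-- The regularized risk of `f ∈ H` with respect to an arbitrary probability measure. -/
def regRisk (L : X → Y → G → ℝ) (lam : ℝ) (J : ProbabilityMeasure (X × Y)) (f : H) : ℝ :=
  realRisk L J f + lam * ‖f‖ ^ 2

variable (H) in
/-- The minimizer over `H` of the regularized risk with respect to a probability measure. -/
def regMinimizer (L : X → Y → G → ℝ) (lam : ℝ) (J : ProbabilityMeasure (X × Y)) : H :=
  Classical.epsilon fun f : H => ∀ g : H, regRisk L lam J f ≤ regRisk L lam J g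

/-- The gradient of the loss along `f`, mapped to `H` by the feature map: the gradient at `f` of the
loss at a single observation. -/
def featureGradient (L : X → Y → G → ℝ) (f : H) (p : X × Y) : H :=
  RKHS.kerFun H p.1 (gradient (L p.1 p.2) (f p.1))

namespace IsRegularSetting

variable {L : X → Y → G → ℝ} {κ : ℝ}

theorem norm_apply_le (h : IsRegularSetting H L κ) (f : H) (x : X) : ‖f x‖ ≤ κ * ‖f‖ := by
  have h1 := RKHS.norm_apply_le f x
  rw [← RKHS.norm_kerFun_eq_sqrt_norm_kernel] at h1
  rw [mul_comm]
  exact h1.trans (mul_le_mul_of_nonneg_left (h.norm_kerFun_le x) (norm_nonneg f))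

theorem norm_apply_le_of_norm_le (h : IsRegularSetting H L κ) {f : H} {r : ℝ} (hf : ‖f‖ ≤ r)
    (x : X) : ‖f x‖ ≤ κ * r :=
  (h.norm_apply_le f x).trans (mul_le_mul_of_nonneg_left hf h.nonneg)

theorem measurable_loss_comp (h : IsRegularSetting H L κ) (f : H) :
    Measurable fun p : X × Y => L p.1 p.2 (f p.1) :=
  h.isLoss.measurable.comp (measurable_fst.prodMk
    (measurable_snd.prodMk ((h.continuous_coe f).measurable.comp measurable_fst)))

theorem exists_loss_bound (h : IsRegularSetting H L κ) (r : ℝ) :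
    ∃ B : ℝ, 0 ≤ B ∧ ∀ x y t, ‖t‖ ≤ r → |L x y t| ≤ B := by
  obtain ⟨B, hB⟩ := h.isLocallyBoundedLoss (Metric.closedBall 0 r) Metric.isBounded_closedBall
  refine ⟨max B 0, le_max_right _ _, fun x y t ht => (hB x y t ?_).trans (le_max_left _ _)⟩
  simpa using ht

theorem exists_loss_lipschitz (h : IsRegularSetting H L κ) (r : ℝ) :
    ∃ M : ℝ, 0 ≤ M ∧ ∀ x y t t', ‖t‖ ≤ r → ‖t'‖ ≤ r → |L x y t - L x y t'| ≤ M * ‖t - t'‖ := by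
  obtain ⟨M, hM⟩ := h.isLocallyLipschitzLoss (max r 1) (by positivity)
  refine ⟨max M 0, le_max_right _ _, fun x y t t' ht ht' => ?_⟩
  exact (hM x y t t' (ht.trans (le_max_left _ _)) (ht'.trans (le_max_left _ _))).trans
    (mul_le_mul_of_nonneg_right (le_max_left _ _) (norm_nonneg _))

theorem hasGradientAt_loss (h : IsRegularSetting H L κ) (x : X) (y : Y) (t : G) :
    HasGradientAt (L x y) (gradient (L x y) t) t :=
  ((h.isContDiffLoss.differentiable x y) t).hasGradientAt

theorem hasDerivAt_loss_line (h : IsRegularSetting H L κ) (x : X) (y : Y) (t v : G) (s : ℝ) :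
    HasDerivAt (fun s : ℝ => L x y (t + s • v)) (inner ℝ (gradient (L x y) (t + s • v)) v) s := by
  have h1 : HasDerivAt (fun s : ℝ => t + s • v) v s := by
    simpa using ((hasDerivAt_id s).smul_const v).const_add t
  simpa [Function.comp_def] using
    (hasGradientAt_iff_hasFDerivAt.mp (h.hasGradientAt_loss x y (t + s • v))).comp_hasDerivAt s h1

/-- On the segment from `t` to `t'` a convex function has its derivative at 0 bounded by its slope
over [0, 1]. -/
theorem inner_gradient_le (h : IsRegularSetting H L κ) (x : X) (y : Y) (t t' : G) :
    inner ℝ (gradient (L x y) t) (t' - t) ≤ L x y t' - L x y t := by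
  have hconv : ConvexOn ℝ Set.univ fun s : ℝ => L x y (t + s • (t' - t)) := by
    have := (h.isConvexLoss x y).comp_affineMap (AffineMap.lineMap (k := ℝ) t t')
    refine (this.congr fun s _ => ?_)
    simp [AffineMap.lineMap_apply, add_comm]
  have h1 := hconv.le_slope_of_hasDerivAt (Set.mem_univ 0) (Set.mem_univ 1) one_pos
    (h.hasDerivAt_loss_line x y t (t' - t) 0)
  simpa [slope_def_field] using h1

/-- A local Lipschitz constant bounds the derivative. The radius `r + 1` leaves a unit neighbourhood
of every point of the ball of radius `r`. -/
theorem exists_gradient_bound (h : IsRegularSetting H L κ) (r : ℝ) :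
    ∃ M : ℝ, 0 ≤ M ∧ ∀ x y t, ‖t‖ ≤ r → ‖gradient (L x y) t‖ ≤ M := by
  obtain ⟨M, hM0, hM⟩ := h.exists_loss_lipschitz (r + 1)
  refine ⟨M, hM0, fun x y t ht => ?_⟩
  have h1 := (hasGradientAt_iff_hasFDerivAt.mp (h.hasGradientAt_loss x y t)).le_of_lip' hM0 (by
    filter_upwards [Metric.ball_mem_nhds t one_pos] with t' ht'
    rw [Metric.mem_ball, dist_eq_norm] at ht'
    refine hM x y t' t ?_ (by linarith)
    have := norm_le_norm_add_norm_sub' t' t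
    linarith)
  rwa [LinearIsometryEquiv.norm_map] at h1

theorem integrable_loss (h : IsRegularSetting H L κ) (J : ProbabilityMeasure (X × Y)) (f : H) :
    Integrable (fun p : X × Y => L p.1 p.2 (f p.1)) (J : Measure (X × Y)) := by
  obtain ⟨B, -, hB⟩ := h.exists_loss_bound (κ * ‖f‖)
  exact Integrable.of_bound (h.measurable_loss_comp f).aestronglyMeasurable B
    (ae_of_all _ fun p => hB _ _ _ (h.norm_apply_le f p.1))

theorem realRisk_nonneg (h : IsRegularSetting H L κ) (J : ProbabilityMeasure (X × Y))
    (f : X → G) : 0 ≤ realRisk L J f :=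
  integral_nonneg fun _ => h.isLoss.nonneg _ _ _

theorem risk_eq_ofReal (h : IsRegularSetting H L κ) (J : ProbabilityMeasure (X × Y)) (f : H) :
    risk L J f = ENNReal.ofReal (realRisk L J f) :=
  (ofReal_integral_eq_lintegral_ofReal (h.integrable_loss J f)
    (ae_of_all _ fun _ => h.isLoss.nonneg _ _ _)).symm

theorem exists_realRisk_lipschitz (h : IsRegularSetting H L κ) (r : ℝ) :
    ∃ M : ℝ, 0 ≤ M ∧ ∀ (J : ProbabilityMeasure (X × Y)) (f g : H), ‖f‖ ≤ r → ‖g‖ ≤ r →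
      |realRisk L J f - realRisk L J g| ≤ M * ‖f - g‖ := by
  obtain ⟨M, hM0, hM⟩ := h.exists_loss_lipschitz (κ * r)
  refine ⟨M * κ, mul_nonneg hM0 h.nonneg, fun J f g hf hg => ?_⟩
  rw [realRisk, realRisk, ← integral_sub (h.integrable_loss J f) (h.integrable_loss J g)]
  have := norm_integral_le_of_norm_le_const (μ := (J : Measure (X × Y)))
    (f := fun p : X × Y => L p.1 p.2 (f p.1) - L p.1 p.2 (g p.1)) (C := M * κ * ‖f - g‖)
    (ae_of_all _ fun p => by
      refine (hM _ _ _ _ (h.norm_apply_le_of_norm_le hf p.1)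
        (h.norm_apply_le_of_norm_le hg p.1)).trans ?_
      rw [mul_assoc]
      refine mul_le_mul_of_nonneg_left ?_ hM0
      simpa using h.norm_apply_le (f - g) p.1)
  simpa using this

theorem continuous_realRisk (h : IsRegularSetting H L κ) (J : ProbabilityMeasure (X × Y)) :
    Continuous fun f : H => realRisk L J f := by
  rw [continuous_iff_continuousAt]
  intro f
  obtain ⟨M, hM0, hM⟩ := h.exists_realRisk_lipschitz (‖f‖ + 1)
  refine tendsto_iff_norm_sub_tendsto_zero.mpr (squeeze_zero' (Eventually.of_forall fun _ =>
    norm_nonneg _) (?_ : ∀ᶠ g in 𝓝 f, _ ≤ M * ‖g - f‖) ?_)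
  · filter_upwards [Metric.ball_mem_nhds f one_pos] with g hg
    rw [Metric.mem_ball, dist_eq_norm] at hg
    refine hM J g f ?_ (by linarith)
    have := norm_le_norm_add_norm_sub' g f
    linarith
  · have : Continuous fun g : H => M * ‖g - f‖ := by fun_prop
    simpa using this.tendsto f

theorem continuous_regRisk (h : IsRegularSetting H L κ) (lam : ℝ)
    (J : ProbabilityMeasure (X × Y)) : Continuous fun f : H => regRisk L lam J f := by
  have := h.continuous_realRisk J
  unfold regRisk
  fun_prop

theorem realRisk_midpoint_le (h : IsRegularSetting H L κ) (J : ProbabilityMeasure (X × Y))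
    (f g : H) : realRisk L J ((1 / 2 : ℝ) • (f + g) : H) ≤
      (realRisk L J f + realRisk L J g) / 2 := by
  rw [realRisk, realRisk, realRisk,
    ← integral_add (h.integrable_loss J f) (h.integrable_loss J g), ← integral_div]
  refine integral_mono (h.integrable_loss J _)
    (((h.integrable_loss J f).add (h.integrable_loss J g)).div_const 2) fun p => ?_
  have h1 := (h.isConvexLoss p.1 p.2).2 (Set.mem_univ (f p.1)) (Set.mem_univ (g p.1))
    (show (0 : ℝ) ≤ 1 / 2 by norm_num) (show (0 : ℝ) ≤ 1 / 2 by norm_num) (by norm_num)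
  simp only [smul_eq_mul] at h1
  simp only [RKHS.coe_smul, RKHS.coe_add, Pi.smul_apply, Pi.add_apply, smul_add]
  linarith

/-- The risk is midpoint convex, and by the parallelogram law the penalty contributes the strong
convexity constant λ/4. -/
theorem existsUnique_regRisk_minimizer (h : IsRegularSetting H L κ) {lam : ℝ} (hlam : 0 < lam)
    (J : ProbabilityMeasure (X × Y)) :
    ∃! f : H, ∀ g : H, regRisk L lam J f ≤ regRisk L lam J g := by
  refine existsUnique_forall_le_of_midpoint (h.continuous_regRisk lam J)
    (fun f => add_nonneg (h.realRisk_nonneg J f) (by positivity))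
    (show 0 < lam / 4 by positivity) fun f g => ?_
  have h1 := h.realRisk_midpoint_le J f g
  have h2 := parallelogram_law_with_norm ℝ f g
  have h3 : ‖(1 / 2 : ℝ) • (f + g)‖ ^ 2 = ‖f + g‖ ^ 2 / 4 := by
    rw [norm_smul, mul_pow]
    norm_num
    ring
  have h4 : lam * (‖f + g‖ ^ 2 + ‖f - g‖ ^ 2) = lam * (2 * (‖f‖ ^ 2 + ‖g‖ ^ 2)) := by rw [h2]
  simp only [regRisk]
  rw [h3]
  linarith

theorem regRisk_regMinimizer_le (h : IsRegularSetting H L κ) {lam : ℝ} (hlam : 0 < lam)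
    (J : ProbabilityMeasure (X × Y)) (g : H) :
    regRisk L lam J (regMinimizer H L lam J) ≤ regRisk L lam J g :=
  Classical.epsilon_spec (h.existsUnique_regRisk_minimizer hlam J).exists g

theorem regularizedRisk_eq (h : IsRegularSetting H L κ) {lam : ℝ} (hlam : 0 < lam) {n : ℕ}
    (z : Fin (n + 1) → X × Y) (f : H) :
    regularizedRisk L lam z f = ENNReal.ofReal (regRisk L lam (empiricalMeasure z) f) := by
  rw [regularizedRisk, h.risk_eq_ofReal, regRisk,
    ENNReal.ofReal_add (h.realRisk_nonneg _ _) (by positivity)]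

theorem isSVMSolution_iff (h : IsRegularSetting H L κ) {lam : ℝ} (hlam : 0 < lam) {n : ℕ}
    (z : Fin (n + 1) → X × Y) (f : H) :
    IsSVMSolution L lam z f ↔
      ∀ g : H, regRisk L lam (empiricalMeasure z) f ≤ regRisk L lam (empiricalMeasure z) g := by
  refine forall_congr' fun g => ?_
  rw [h.regularizedRisk_eq hlam, h.regularizedRisk_eq hlam, ENNReal.ofReal_le_ofReal_iff]
  exact add_nonneg (h.realRisk_nonneg _ _) (by positivity)

theorem existsUnique_isSVMSolution (h : IsRegularSetting H L κ) {lam : ℝ} (hlam : 0 < lam) {n : ℕ}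
    (z : Fin (n + 1) → X × Y) : ∃! f : H, IsSVMSolution L lam z f := by
  simp_rw [h.isSVMSolution_iff hlam]
  exact h.existsUnique_regRisk_minimizer hlam _

/-- The two minimality predicates are equivalent, so `Classical.epsilon` picks the same element for
both. -/
theorem svmSolution_eq (h : IsRegularSetting H L κ) {lam : ℝ} (hlam : 0 < lam) {n : ℕ}
    (z : Fin (n + 1) → X × Y) :
    svmSolution H L lam z = regMinimizer H L lam (empiricalMeasure z) := by
  simp only [svmSolution, regMinimizer, h.isSVMSolution_iff hlam]

/-- Comparison with the zero function gives λ‖f‖² ≤ B, where `B` bounds the loss at t = 0; this does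
not depend on the measure. -/
theorem exists_norm_regMinimizer_le (h : IsRegularSetting H L κ) {lam : ℝ} (hlam : 0 < lam) :
    ∃ r : ℝ, ∀ J, ‖regMinimizer H L lam J‖ ≤ r := by
  obtain ⟨B, hB0, hB⟩ := h.exists_loss_bound 0
  refine ⟨Real.sqrt (B / lam), fun J => Real.le_sqrt_of_sq_le ?_⟩
  rw [le_div_iff₀ hlam]
  have h1 := h.regRisk_regMinimizer_le hlam J 0
  have h2 := h.realRisk_nonneg J (regMinimizer H L lam J)
  have h3 : realRisk L J (0 : H) ≤ B := by
    have := norm_integral_le_of_norm_le_const (μ := (J : Measure (X × Y)))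
      (f := fun p : X × Y => L p.1 p.2 ((0 : H) p.1)) (C := B)
      (ae_of_all _ fun p => hB _ _ _ (by simp))
    exact (le_abs_self _).trans (by simpa [realRisk] using this)
  simp only [regRisk, norm_zero] at h1
  linarith

/-! ### Gradient of the risk and stability of the minimizer -/

theorem continuous_gradient_comp (h : IsRegularSetting H L κ) (f : H) :
    Continuous fun p : X × Y => gradient (L p.1 p.2) (f p.1) :=
  h.isContDiffLoss.continuous_gradient.comp (continuous_fst.prodMk
    (continuous_snd.prodMk ((h.continuous_coe f).comp continuous_fst)))

theorem continuous_featureGradient (h : IsRegularSetting H L κ) (f : H) :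
    Continuous (featureGradient L f : X × Y → H) :=
  (h.continuous_kerFun.comp continuous_fst).clm_apply (h.continuous_gradient_comp f)

theorem exists_featureGradient_bound (h : IsRegularSetting H L κ) (f : H) :
    ∃ C : ℝ, ∀ p : X × Y, ‖featureGradient L f p‖ ≤ C := by
  obtain ⟨M, hM0, hM⟩ := h.exists_gradient_bound (κ * ‖f‖)
  refine ⟨κ * M, fun p => (ContinuousLinearMap.le_opNorm _ _).trans ?_⟩
  exact mul_le_mul (h.norm_kerFun_le _) (hM _ _ _ (h.norm_apply_le f p.1)) (norm_nonneg _) h.nonneg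

theorem integrable_featureGradient (h : IsRegularSetting H L κ) (J : ProbabilityMeasure (X × Y))
    (f : H) : Integrable (featureGradient L f : X × Y → H) (J : Measure (X × Y)) := by
  obtain ⟨C, hC⟩ := h.exists_featureGradient_bound f
  exact integrable_of_continuous_of_norm_le _ (h.continuous_featureGradient f) hC

theorem inner_featureGradient (f g : H) (p : X × Y) :
    inner ℝ (featureGradient L f p) g = inner ℝ (gradient (L p.1 p.2) (f p.1)) (g p.1) := by
  rw [featureGradient, RKHS.kerFun_inner]

theorem inner_integral_featureGradient (h : IsRegularSetting H L κ)
    (J : ProbabilityMeasure (X × Y)) (f g : H) :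
    inner ℝ (∫ p, featureGradient L f p ∂(J : Measure (X × Y))) g =
      ∫ p, inner ℝ (gradient (L p.1 p.2) (f p.1)) (g p.1) ∂(J : Measure (X × Y)) := by
  rw [real_inner_comm, ← integral_inner (h.integrable_featureGradient J f)]
  refine integral_congr_ae (ae_of_all _ fun p => ?_)
  simp only
  rw [real_inner_comm, inner_featureGradient]

/-- Differentiation under the integral sign: for |s| < 1 all values of f + s g lie in one ball,
where the gradients of the loss are uniformly bounded. -/
theorem hasDerivAt_realRisk_line (h : IsRegularSetting H L κ) (J : ProbabilityMeasure (X × Y))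
    (f g : H) : HasDerivAt (fun s : ℝ => realRisk L J (f + s • g : H))
      (inner ℝ (∫ p, featureGradient L f p ∂(J : Measure (X × Y))) g) 0 := by
  obtain ⟨M, hM0, hM⟩ := h.exists_gradient_bound (κ * (‖f‖ + ‖g‖))
  have h1 := (hasDerivAt_integral_of_dominated_loc_of_deriv_le (μ := (J : Measure (X × Y)))
    (F := fun (s : ℝ) (p : X × Y) => L p.1 p.2 ((f + s • g : H) p.1))
    (F' := fun (s : ℝ) (p : X × Y) =>
      inner ℝ (gradient (L p.1 p.2) ((f + s • g : H) p.1)) (g p.1))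
    (bound := fun _ => M * (κ * ‖g‖)) (x₀ := 0) (Metric.ball_mem_nhds 0 one_pos)
    (Eventually.of_forall fun s => (h.measurable_loss_comp _).aestronglyMeasurable)
    (h.integrable_loss J _)
    (((h.continuous_gradient_comp _).inner
      ((h.continuous_coe g).comp continuous_fst)).measurable.aestronglyMeasurable)
    (ae_of_all _ fun p s hs => by
      have hs1 : ‖s‖ ≤ 1 := by simpa using (Metric.mem_ball.mp hs).le
      refine (norm_inner_le_norm _ _).trans (mul_le_mul (hM _ _ _ ?_) (h.norm_apply_le g p.1)
        (norm_nonneg _) hM0)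
      refine h.norm_apply_le_of_norm_le ((norm_add_le _ _).trans ?_) p.1
      rw [norm_smul]
      gcongr
      exact mul_le_of_le_one_left (norm_nonneg g) hs1)
    (integrable_const _)
    (ae_of_all _ fun p s _ => by
      simpa using h.hasDerivAt_loss_line p.1 p.2 (f p.1) (g p.1) s)).2
  rw [h.inner_integral_featureGradient]
  simpa [realRisk] using h1

/-- The first order optimality condition for the regularized risk. -/
theorem inner_integral_featureGradient_regMinimizer (h : IsRegularSetting H L κ) {lam : ℝ}
    (hlam : 0 < lam) (J : ProbabilityMeasure (X × Y)) (g : H) :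
    inner ℝ (∫ p, featureGradient L (regMinimizer H L lam J) p ∂(J : Measure (X × Y))) g =
      -(2 * lam * inner ℝ (regMinimizer H L lam J) g) := by
  set f := regMinimizer H L lam J
  have h1 := h.hasDerivAt_realRisk_line J f g
  have h2 : HasDerivAt (fun s : ℝ => lam * ‖f + s • g‖ ^ 2) (lam * (2 * inner ℝ f g)) 0 := by
    have hl : HasDerivAt (fun s : ℝ => f + s • g) g 0 := by
      simpa using ((hasDerivAt_id (0 : ℝ)).smul_const g).const_add f
    simpa using (hl.norm_sq).const_mul lam
  have h3 := IsLocalMin.hasDerivAt_eq_zero (f := fun s : ℝ => regRisk L lam J (f + s • g))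
    (Eventually.of_forall fun s => by
      simpa using h.regRisk_regMinimizer_le hlam J (f + s • g)) (h1.add h2)
  linarith

theorem inner_integral_featureGradient_le (h : IsRegularSetting H L κ)
    (J : ProbabilityMeasure (X × Y)) (f g : H) :
    inner ℝ (∫ p, featureGradient L f p ∂(J : Measure (X × Y))) (g - f) ≤
      realRisk L J g - realRisk L J f := by
  rw [h.inner_integral_featureGradient, realRisk, realRisk,
    ← integral_sub (h.integrable_loss J g) (h.integrable_loss J f)]
  refine integral_mono ?_ ((h.integrable_loss J g).sub (h.integrable_loss J f)) fun p => ?_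
  · refine ((h.integrable_featureGradient J f).inner_const (g - f)).congr (ae_of_all _ fun p => ?_)
    exact inner_featureGradient f (g - f) p
  · simpa using h.inner_gradient_le p.1 p.2 (f p.1) (g p.1)

/-- Stability of the minimizer of the regularized risk. -/
theorem norm_regMinimizer_sub_le (h : IsRegularSetting H L κ) {lam : ℝ} (hlam : 0 < lam)
    (J J' : ProbabilityMeasure (X × Y)) :
    lam * ‖regMinimizer H L lam J' - regMinimizer H L lam J‖ ≤
      ‖∫ p, featureGradient L (regMinimizer H L lam J) p ∂(J' : Measure (X × Y)) -
        ∫ p, featureGradient L (regMinimizer H L lam J) p ∂(J : Measure (X × Y))‖ := by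
  set f := regMinimizer H L lam J with hf
  set g := regMinimizer H L lam J' with hg
  have h1 := h.regRisk_regMinimizer_le hlam J' f
  have h2 := h.inner_integral_featureGradient_le J' f g
  have h3 := h.inner_integral_featureGradient_regMinimizer hlam J (g - f)
  rw [← hf] at h3
  rw [← hg] at h1
  simp only [regRisk] at h1
  set a := ∫ p, featureGradient L f p ∂(J' : Measure (X × Y))
  set b := ∫ p, featureGradient L f p ∂(J : Measure (X × Y))
  have h4 : ‖g‖ ^ 2 = ‖f‖ ^ 2 + 2 * inner ℝ f (g - f) + ‖g - f‖ ^ 2 := by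
    have := norm_add_sq_real f (g - f)
    rwa [add_sub_cancel] at this
  have h5 : -inner ℝ (a - b) (g - f) ≤ ‖a - b‖ * ‖g - f‖ :=
    (neg_le_abs _).trans (abs_real_inner_le_norm _ _)
  rw [inner_sub_left] at h5
  rw [h4] at h1
  -- Adding minimality of `g` for `J'`, the subgradient inequality for `J'` at `f`, and the
  -- optimality condition for `J` at `f` cancels both risks and the cross term, leaving λ‖g - f‖² ≤
  -- -⟪a - b, g - f⟫.
  have h6 : lam * ‖g - f‖ * ‖g - f‖ ≤ ‖a - b‖ * ‖g - f‖ := by nlinarith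
  rcases (norm_nonneg (g - f)).eq_or_lt with h0 | h0
  · rw [← h0, mul_zero]
    exact norm_nonneg _
  · exact le_of_mul_le_mul_right h6 h0

/-- The minimizer of the regularized risk depends continuously on the probability measure. -/
theorem continuous_regMinimizer (h : IsRegularSetting H L κ) {lam : ℝ} (hlam : 0 < lam) :
    Continuous (regMinimizer H L lam) := by
  rw [continuous_iff_continuousAt]
  intro J
  obtain ⟨C, hC⟩ := h.exists_featureGradient_bound (regMinimizer H L lam J)
  have h1 := tendsto_integral_hilbert (tendsto_id (x := 𝓝 J))
    (h.continuous_featureGradient (regMinimizer H L lam J)) hC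
  have h2 := (tendsto_iff_norm_sub_tendsto_zero.mp h1).const_mul lam⁻¹
  rw [mul_zero] at h2
  refine tendsto_iff_norm_sub_tendsto_zero.mpr (squeeze_zero (fun _ => norm_nonneg _)
    (fun J' => ?_) h2)
  rw [← div_eq_inv_mul, le_div_iff₀ hlam, mul_comm]
  exact h.norm_regMinimizer_sub_le hlam J J'

end IsRegularSetting

end RegularizedRisk

/-! ### Measurability of empirical measures and separability -/

theorem measurable_empiricalMeasure_sample {Ω S : Type*} [MeasurableSpace Ω] [MeasurableSpace S]
    {Z : ℕ → Ω → S} (hZ : ∀ n, Measurable (Z n)) (n : ℕ) :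
    Measurable fun ω => empiricalMeasure (sample Z n ω) := by
  refine Measurable.subtype_mk (Measure.measurable_of_measurable_coe _ fun s hs => ?_)
  simp only [Measure.smul_apply, Measure.coe_finsetSum, Finset.sum_apply, smul_eq_mul]
  refine (Finset.measurable_fun_sum _ fun i _ => ?_).const_mul _
  exact (Measure.measurable_coe hs).comp (Measure.measurable_dirac.comp (hZ i))

/-- If `E` is nontrivial, then the space of bounded continuous real functions is separable as soon
as the space of bounded continuous `E`-valued functions is. -/
theorem separableSpace_boundedContinuousFunction_real {S E : Type*} [TopologicalSpace S]
    [NormedAddCommGroup E] [InnerProductSpace ℝ E] [Nontrivial E]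
    [TopologicalSpace.SeparableSpace (S →ᵇ E)] : TopologicalSpace.SeparableSpace (S →ᵇ ℝ) := by
  -- Pairing with a unit vector `v` maps onto the real functions: f is the image of f · v.
  obtain ⟨v, hv⟩ := exists_norm_eq E (zero_le_one' ℝ)
  have hsurj : Function.Surjective ((innerSL ℝ v).compLeftContinuousBounded S) := by
    intro f
    refine ⟨(ContinuousLinearMap.toSpanSingleton ℝ v).compLeftContinuousBounded S f, ?_⟩
    ext s
    simp [hv]
  exact hsurj.denseRange.separableSpace (ContinuousLinearMap.continuous _)

/-! ### Excess risk and consistency -/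

section Consistency

set_option linter.unusedSectionVars false

variable {Ω X Y G H : Type*} [MeasurableSpace Ω]
  [TopologicalSpace X] [SecondCountableTopology X] [MeasurableSpace X] [BorelSpace X]
  [TopologicalSpace Y] [SecondCountableTopology Y] [MeasurableSpace Y] [BorelSpace Y]
  [NormedAddCommGroup G] [InnerProductSpace ℝ G] [CompleteSpace G]
  [SecondCountableTopology G] [MeasurableSpace G] [BorelSpace G]
  [NormedAddCommGroup H] [InnerProductSpace ℝ H] [CompleteSpace H]
  [SecondCountableTopology H] [RKHS ℝ H X G]

namespace IsRegularSetting

variable {L : X → Y → G → ℝ} {κ : ℝ}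

theorem measurable_realRisk (h : IsRegularSetting H L κ) [MeasurableSpace H] [BorelSpace H]
    {J : Ω → ProbabilityMeasure (X × Y)} (hJ : Measurable J) {F : Ω → H} (hF : Measurable F) :
    Measurable fun ω => realRisk L (J ω) (F ω) := by
  -- Evaluation at x is the adjoint of the feature map at x. Norm continuity of the feature map
  -- therefore makes evaluation jointly continuous.
  have heval : Continuous fun q : H × X => q.1 q.2 := by
    have h1 : Continuous fun q : H × X => (RKHS.kerFun H q.2).adjoint q.1 :=
      (ContinuousLinearMap.adjoint.continuous.comp
        (h.continuous_kerFun.comp continuous_snd)).clm_apply continuous_fst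
    simpa using h1
  let ρ : ProbabilityTheory.Kernel Ω (X × Y) :=
    ⟨fun ω => (J ω : Measure (X × Y)), measurable_subtype_coe.comp hJ⟩
  have hρ : ProbabilityTheory.IsMarkovKernel ρ := ⟨fun ω => (J ω).2⟩
  have hm : Measurable fun q : Ω × X × Y => L q.2.1 q.2.2 (F q.1 q.2.1) :=
    h.isLoss.measurable.comp (measurable_snd.fst.prodMk (measurable_snd.snd.prodMk
      (heval.measurable.comp ((hF.comp measurable_fst).prodMk measurable_snd.fst))))
  exact (StronglyMeasurable.integral_kernel_prod_right (κ := ρ)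
    (f := fun ω p => L p.1 p.2 (F ω p.1)) hm.stronglyMeasurable).measurable

theorem bayesRisk_le (h : IsRegularSetting H L κ) (J : ProbabilityMeasure (X × Y)) (f : H) :
    bayesRisk L J ≤ ENNReal.ofReal (realRisk L J f) := by
  rw [← h.risk_eq_ofReal]
  exact iInf₂_le (f : X → G) (h.continuous_coe f).measurable

theorem bayesRisk_ne_top (h : IsRegularSetting H L κ) (J : ProbabilityMeasure (X × Y)) :
    bayesRisk L J ≠ ∞ :=
  ne_top_of_le_ne_top ENNReal.ofReal_ne_top (h.bayesRisk_le J 0)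

theorem toReal_bayesRisk_le (h : IsRegularSetting H L κ) (J : ProbabilityMeasure (X × Y))
    (f : H) : (bayesRisk L J).toReal ≤ realRisk L J f :=
  ENNReal.toReal_le_of_le_ofReal (h.realRisk_nonneg J f) (h.bayesRisk_le J f)

/-- Over a rich hypothesis space, the risk of the regularized minimizer tends to the Bayes risk
as the regularization parameter tends to zero. -/
theorem tendsto_realRisk_regMinimizer (h : IsRegularSetting H L κ)
    {J : ProbabilityMeasure (X × Y)}
    (hJ : IsRich (Set.range fun f : H => (f : X → G)) L J) {ι : Type*} {l : Filter ι}
    {lam : ι → ℝ} (hpos : ∀ i, 0 < lam i) (hlam : Tendsto lam l (𝓝 0)) :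
    Tendsto (fun i => realRisk L J (regMinimizer H L (lam i) J)) l
      (𝓝 (bayesRisk L J).toReal) := by
  refine tendsto_order.mpr ⟨fun a ha => Eventually.of_forall fun i =>
    ha.trans_le (h.toReal_bayesRisk_le J _), fun a ha => ?_⟩
  have h1 : bayesRisk L J < ENNReal.ofReal a :=
    (ENNReal.lt_ofReal_iff_toReal_lt (h.bayesRisk_ne_top J)).mpr ha
  rw [← hJ, iInf_range, iInf_lt_iff] at h1
  obtain ⟨f, hf⟩ := h1
  rw [h.risk_eq_ofReal, ENNReal.ofReal_lt_ofReal_iff_of_nonneg (h.realRisk_nonneg J f)] at hf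
  have h2 : Tendsto (fun i => regRisk L (lam i) J f) l (𝓝 (realRisk L J f)) := by
    simpa [regRisk] using (hlam.mul_const (‖f‖ ^ 2)).const_add (realRisk L J f)
  filter_upwards [h2.eventually (gt_mem_nhds hf)] with i hi
  have h3 := h.regRisk_regMinimizer_le (hpos i) J f
  have h4 : realRisk L J (regMinimizer H L (lam i) J) ≤
      regRisk L (lam i) J (regMinimizer H L (lam i) J) :=
    le_add_of_nonneg_right (mul_nonneg (hpos i).le (sq_nonneg _))
  linarith

/-- The excess risk of a regularized minimizer is at most an approximation error and a multiple of
the distance to the regularized minimizer of the limit measure. -/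
theorem exists_excess_le (h : IsRegularSetting H L κ) {lam : ℝ} (hlam : 0 < lam) :
    ∃ M : ℝ, 0 < M ∧ ∀ J J' : ProbabilityMeasure (X × Y),
      realRisk L J (regMinimizer H L lam J') ≤ realRisk L J (regMinimizer H L lam J) +
        M * dist (regMinimizer H L lam J') (regMinimizer H L lam J) := by
  obtain ⟨r, hr⟩ := h.exists_norm_regMinimizer_le hlam
  obtain ⟨M, hM0, hM⟩ := h.exists_realRisk_lipschitz r
  -- Adding 1 makes the constant strictly positive, so that it can be divided by later.
  refine ⟨M + 1, by positivity, fun J J' => ?_⟩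
  have h1 := (le_abs_self _).trans (hM J _ _ (hr J') (hr J))
  rw [dist_eq_norm]
  linarith [norm_nonneg (regMinimizer H L lam J' - regMinimizer H L lam J)]

theorem risk_svm (h : IsRegularSetting H L κ) (hH : ∀ f : H, Measurable (f : X → G)) {lam : ℕ → ℝ}
    (hlam : ∀ n, 0 < lam n) (J : ProbabilityMeasure (X × Y)) (n : ℕ)
    (z : Fin (n + 1) → X × Y) :
    risk L J (svm H hH L lam n z).1 =
      ENNReal.ofReal (realRisk L J (regMinimizer H L (lam n) (empiricalMeasure z))) := by
  rw [← h.svmSolution_eq (hlam n), ← h.risk_eq_ofReal]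
  rfl

/-- The excess risk splits into the approximation error of the minimizer for `J`, which tends to 0
almost surely and hence in probability, and an estimation error handled by the diagonal sequence. -/
theorem exists_isConsistent [OpensMeasurableSpace (ProbabilityMeasure (X × Y))]
    (h : IsRegularSetting H L κ) (hH : ∀ f : H, Measurable (f : X → G)) (P : Measure Ω)
    [IsProbabilityMeasure P] {Z : ℕ → Ω → X × Y} {J : Ω → ProbabilityMeasure (X × Y)}
    (hrich : ∀ᵐ ω ∂P, IsRich (Set.range fun f : H => (f : X → G)) L (J ω))
    (hZ : IsEWCInProb P Z J) :
    ∃ lam : ℕ → ℝ, (∀ n, 0 < lam n) ∧ Tendsto lam atTop (𝓝 0) ∧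
      IsConsistent P L (svm H hH L lam) Z J := by
  borelize H
  have hpos : ∀ k : ℕ, (0 : ℝ) < 1 / ((k : ℝ) + 1) := fun k => Nat.one_div_pos_of_nat
  choose M hM0 hM using fun k : ℕ => h.exists_excess_le (hpos k)
  obtain ⟨d, hd, hconv⟩ := hZ.tendsto
  obtain ⟨κ', hκ, hD⟩ := exists_diagonal_tendsto_measure P
    (D := fun k n ω => M k * dist
      (regMinimizer H L (1 / ((k : ℝ) + 1)) (empiricalMeasure (sample Z n ω)))
      (regMinimizer H L (1 / ((k : ℝ) + 1)) (J ω))) (fun k δ hδ => by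
        have h1 := tendsto_measure_dist_comp P d hd hZ.measurable_limit hconv
          (h.continuous_regMinimizer (hpos k)) (div_pos hδ (hM0 k))
        simpa only [div_le_iff₀' (hM0 k)] using h1)
  have hlam : Tendsto (fun n => 1 / ((κ' n : ℝ) + 1)) atTop (𝓝 0) :=
    tendsto_one_div_add_atTop_nhds_zero_nat.comp hκ
  refine ⟨fun n => 1 / ((κ' n : ℝ) + 1), fun n => hpos _, hlam, ?_⟩
  have happrox : TendstoInMeasure P
      (fun n ω => realRisk L (J ω) (regMinimizer H L (1 / ((κ' n : ℝ) + 1)) (J ω))) atTop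
      fun ω => (bayesRisk L (J ω)).toReal := by
    refine tendstoInMeasure_of_tendsto_ae (fun n => ?_) ?_
    · exact (h.measurable_realRisk hZ.measurable_limit ((h.continuous_regMinimizer
        (hpos (κ' n))).measurable.comp hZ.measurable_limit)).aestronglyMeasurable
    · filter_upwards [hrich] with ω hω
      exact h.tendsto_realRisk_regMinimizer hω (fun n => hpos (κ' n)) hlam
  rw [tendstoInMeasure_iff_dist] at happrox
  -- Risks live in [0, ∞] but are finite here, so the distance to the Bayes risk becomes a real
  -- difference, nonnegative by minimality of the Bayes risk. If it reaches ε, one of the two errors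
  -- reaches ε/2.
  refine tendstoInMeasure_of_ne_top fun ε hε hεtop => ?_
  have hδ : 0 < ε.toReal / 2 := half_pos (ENNReal.toReal_pos hε.ne' hεtop)
  have hsum := (happrox _ hδ).add (hD _ hδ)
  rw [add_zero] at hsum
  refine tendsto_of_tendsto_of_tendsto_of_le_of_le tendsto_const_nhds hsum (fun _ => zero_le)
    fun n => (measure_mono fun ω hω => ?_).trans (measure_union_le _ _)
  have hω' : ε ≤ edist (risk L (J ω) (svm H hH L (fun n => 1 / ((κ' n : ℝ) + 1)) n
    (sample Z n ω)).1) (bayesRisk L (J ω)) := hω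
  rw [h.risk_svm hH (fun n => hpos (κ' n)), edist_eq_ofReal_abs_toReal_sub ENNReal.ofReal_ne_top
    (h.bayesRisk_ne_top _), ENNReal.toReal_ofReal (h.realRisk_nonneg _ _),
    abs_of_nonneg (sub_nonneg.mpr (h.toReal_bayesRisk_le _ _)),
    ENNReal.le_ofReal_iff_toReal_le hεtop (sub_nonneg.mpr (h.toReal_bayesRisk_le _ _))] at hω'
  by_contra hcon
  simp only [Set.mem_union, Set.mem_ofPred_eq, not_or, not_le, Real.dist_eq] at hcon
  have h1 := (abs_lt.mp hcon.1).2
  have h2 := hM (κ' n) (J ω) (empiricalMeasure (sample Z n ω))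
  linarith [hcon.2]

/-- For a fixed outcome the risk is squeezed between the Bayes risk and the sum of approximation and
estimation error; both errors vanish almost surely along the diagonal sequence. -/
theorem exists_isStronglyConsistent [OpensMeasurableSpace (ProbabilityMeasure (X × Y))]
    (h : IsRegularSetting H L κ) (hH : ∀ f : H, Measurable (f : X → G)) (P : Measure Ω)
    [IsProbabilityMeasure P] {Z : ℕ → Ω → X × Y} {J : Ω → ProbabilityMeasure (X × Y)}
    (hrich : ∀ᵐ ω ∂P, IsRich (Set.range fun f : H => (f : X → G)) L (J ω))
    (hZ : IsEWCAlmostSurely P Z J) :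
    ∃ lam : ℕ → ℝ, (∀ n, 0 < lam n) ∧ Tendsto lam atTop (𝓝 0) ∧
      IsStronglyConsistent P L (svm H hH L lam) Z J := by
  borelize H
  have hpos : ∀ k : ℕ, (0 : ℝ) < 1 / ((k : ℝ) + 1) := fun k => Nat.one_div_pos_of_nat
  choose M hM0 hM using fun k : ℕ => h.exists_excess_le (hpos k)
  obtain ⟨κ', hκ, hD⟩ := exists_diagonal_tendsto_ae P
    (D := fun k n ω => M k * dist
      (regMinimizer H L (1 / ((k : ℝ) + 1)) (empiricalMeasure (sample Z n ω)))
      (regMinimizer H L (1 / ((k : ℝ) + 1)) (J ω)))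
    (fun k n => by
      have hF := (h.continuous_regMinimizer (hpos k)).measurable
      exact ((hF.comp (measurable_empiricalMeasure_sample hZ.measurable_process n)).dist
        (hF.comp hZ.measurable_limit)).const_mul _)
    (fun k n ω => mul_nonneg (hM0 k).le dist_nonneg) (fun k => by
      filter_upwards [hZ.tendsto] with ω hω
      have h1 := (tendsto_iff_dist_tendsto_zero.mp
        (((h.continuous_regMinimizer (hpos k)).tendsto (J ω)).comp hω)).const_mul (M k)
      rwa [mul_zero] at h1)
  have hlam : Tendsto (fun n => 1 / ((κ' n : ℝ) + 1)) atTop (𝓝 0) :=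
    tendsto_one_div_add_atTop_nhds_zero_nat.comp hκ
  refine ⟨fun n => 1 / ((κ' n : ℝ) + 1), fun n => hpos _, hlam, ?_⟩
  filter_upwards [hrich, hD] with ω hω hDω
  simp only [h.risk_svm hH (fun n => hpos (κ' n))]
  rw [← ENNReal.ofReal_toReal (h.bayesRisk_ne_top (J ω))]
  refine ENNReal.tendsto_ofReal ?_
  have h1 := (h.tendsto_realRisk_regMinimizer hω (fun n => hpos (κ' n)) hlam).add hDω
  rw [add_zero] at h1
  exact tendsto_of_tendsto_of_tendsto_of_le_of_le tendsto_const_nhds h1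
    (fun n => h.toReal_bayesRisk_le _ _) fun n => hM (κ' n) (J ω) _

end IsRegularSetting

/-- Over a trivial rich hypothesis space, every element has the Bayes risk. -/
theorem risk_eq_bayesRisk_of_subsingleton [Subsingleton H] {L : X → Y → G → ℝ}
    {J : ProbabilityMeasure (X × Y)} (hJ : IsRich (Set.range fun f : H => (f : X → G)) L J)
    (f : H) : risk L J f = bayesRisk L J := by
  rw [← hJ, iInf_range]
  exact le_antisymm (le_iInf fun g => (congrArg (fun g : H => risk L J g)
    (Subsingleton.elim f g)).le) (iInf_le (fun g : H => risk L J g) f)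

end Consistency

end EWCConsistency

end

/-! ### The main theorem -/

theorem mainTheorem1
    -- the probability space
    {Ω : Type*} [MeasurableSpace Ω] (P : Measure Ω) [IsProbabilityMeasure P]
    -- the input space: a locally compact Polish space with its Borel σ-algebra
    {X : Type*} [TopologicalSpace X] [PolishSpace X] [LocallyCompactSpace X]
    [MeasurableSpace X] [BorelSpace X]
    -- the separable Hilbert space of outputs, and the complete set in which data live
    {G : Type*} [NormedAddCommGroup G] [InnerProductSpace ℝ G] [CompleteSpace G]
    [TopologicalSpace.SeparableSpace G] [MeasurableSpace G] [BorelSpace G]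
    (Y : Set G) (hY : IsComplete Y)
    -- the separable reproducing kernel Hilbert space of continuous functions
    {H : Type*} [NormedAddCommGroup H] [InnerProductSpace ℝ H] [CompleteSpace H]
    [TopologicalSpace.SeparableSpace H] [RKHS ℝ H X G]
    (hcont : ∀ f : H, Continuous (f : X → G))
    (hbdd : BddAbove (Set.range fun x : X => Real.sqrt ‖RKHS.kernel H x x‖))
    (hfeature : Continuous fun x : X => RKHS.kerFun H x)
    (hsep : TopologicalSpace.SeparableSpace ((X × Y) →ᵇ H))
    -- the loss
    (L : X → Y → G → ℝ) (hL : EWCConsistency.IsLoss L)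
    (hconvex : EWCConsistency.IsConvexLoss L)
    (hdiff : EWCConsistency.IsContDiffLoss L)
    (hlip : EWCConsistency.IsLocallyLipschitzLoss L)
    (hlocbdd : EWCConsistency.IsLocallyBoundedLoss L)
    -- the input-output process and the random limit measure
    (Z : ℕ → Ω → X × Y) (J : Ω → ProbabilityMeasure (X × Y))
    (hrich : ∀ᵐ ω ∂P,
      EWCConsistency.IsRich (Set.range fun f : H => (f : X → G)) L (J ω)) :
    -- the SVM is well defined
    (∀ lam : ℝ, 0 < lam → ∀ (n : ℕ) (z : Fin (n + 1) → X × Y),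
      ∃! f : H, EWCConsistency.IsSVMSolution L lam z f) ∧
    -- consistency
    (EWCConsistency.IsEWCInProb P Z J →
      ∃ lam : ℕ → ℝ, (∀ n, 0 < lam n) ∧ Tendsto lam atTop (𝓝 0) ∧
        EWCConsistency.IsConsistent P L
          (EWCConsistency.svm H (fun f => (hcont f).measurable) L lam) Z J) ∧
    -- strong consistency
    (EWCConsistency.IsEWCAlmostSurely P Z J →
      ∃ lam : ℕ → ℝ, (∀ n, 0 < lam n) ∧ Tendsto lam atTop (𝓝 0) ∧
        EWCConsistency.IsStronglyConsistent P L
          (EWCConsistency.svm H (fun f => (hcont f).measurable) L lam) Z J) := by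
  have : SecondCountableTopology G := UniformSpace.secondCountable_of_separable G
  have : SecondCountableTopology H := UniformSpace.secondCountable_of_separable H
  obtain ⟨C, hC⟩ := hbdd
  have h : EWCConsistency.IsRegularSetting H L (max C 0) :=
    { continuous_coe := hcont
      nonneg := le_max_right _ _
      norm_kerFun_le := fun x => by
        rw [RKHS.norm_kerFun_eq_sqrt_norm_kernel]
        exact (hC ⟨x, rfl⟩).trans (le_max_left _ _)
      continuous_kerFun := hfeature
      isLoss := hL
      isConvexLoss := hconvex
      isContDiffLoss := hdiff
      isLocallyLipschitzLoss := hlip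
      isLocallyBoundedLoss := hlocbdd }
  refine ⟨fun lam hlam n z => h.existsUnique_isSVMSolution hlam z, ?_⟩
  -- For trivial H, separability of the bounded continuous H-valued functions says nothing about
  -- real-valued ones. Richness then makes the risk equal to the Bayes risk almost surely, and any
  -- positive null sequence works.
  rcases subsingleton_or_nontrivial H with hH | hH
  · refine ⟨fun _ => ?_, fun _ => ?_⟩ <;>
      refine ⟨fun n => 1 / ((n : ℝ) + 1), fun n => Nat.one_div_pos_of_nat,
        tendsto_one_div_add_atTop_nhds_zero_nat, ?_⟩
    · intro ε hε
      refine tendsto_const_nhds.congr fun n => (measure_mono_null (fun ω hω hr => ?_)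
        (ae_iff.mp hrich)).symm
      have hω' : ε ≤ edist (EWCConsistency.risk L (J ω) (EWCConsistency.svmSolution H L
        (1 / ((n : ℝ) + 1)) (EWCConsistency.sample Z n ω))) (EWCConsistency.bayesRisk L (J ω)) := hω
      rw [EWCConsistency.risk_eq_bayesRisk_of_subsingleton hr,
        EWCConsistency.edist_eq_ofReal_abs_toReal_sub (h.bayesRisk_ne_top _)
          (h.bayesRisk_ne_top _), sub_self, abs_zero, ENNReal.ofReal_zero] at hω'
      exact absurd hω' (not_le.mpr hε)
    · filter_upwards [hrich] with ω hω
      exact tendsto_const_nhds.congr fun n =>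
        (EWCConsistency.risk_eq_bayesRisk_of_subsingleton hω _).symm
  · have : TopologicalSpace.SeparableSpace ((X × Y) →ᵇ ℝ) :=
      EWCConsistency.separableSpace_boundedContinuousFunction_real (E := H)
    have : OpensMeasurableSpace (ProbabilityMeasure (X × Y)) :=
      EWCConsistency.opensMeasurableSpace_probabilityMeasure
    exact ⟨h.exists_isConsistent _ P hrich, h.exists_isStronglyConsistent _ P hrich⟩
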